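/- An alternating sign matrix (ASM) of order $m$ is an $m\times m$ matrix with entries in $\{-1,0,1\}$ in which the nonzero entries alternate in sign along each row and each column, and each row and each column has sum $1$. For $n\ge 1$, let $\mathrm{OSASM}(2n)$ be the set of off-diagonally symmetric ASMs of order $2n$, that is, of symmetric ASMs of order $2n$ with all diagonal entries zero. For $A\in\mathrm{OSASM}(2n)$ let $R(A)$ be the number of nonzero strictly upper triangular entries of $A$, and let $T(A)\in\{1,\dots,2n\}$ be the column index of the unique $1$ in the first row of $A$. Put \[ X^{\mathrm O}_{2n}(r,t)=\sum_{A\in\mathrm{OSASM}(2n)} r^{R(A)}t^{T(A)}, \] where $r$ and $t$ are indeterminates. **Theorem.** For every $n\ge 1$, \[ X^{\mathrm O}_{2n}(r,t)=t^{2n+2}\,X^{\mathrm O}_{2n}(r,t^{-1}) \] in $\mathbb Z[r][t,t^{-1}]$. Equivalently, for every integer $r_0\ge 0$ and every integer $t_0$, \[ \bigl|\{A\in\mathrm{OSASM}(2n): R(A)=r_0,\ T(A)=t_0\}\bigr| =\bigl|\{A\in\mathrm{OSASM}(2n): R(A)=r_0,\ T(A)=2n+2-t_0\}\bigr|. \]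 -/

import Mathlib

open scoped Polynomial LaurentPolynomial

/-- The nonzero terms of a finite sequence alternate in sign: two nonzero terms that are separated
only by zeros are opposite (for terms in `{-1, 0, 1}`). -/
def AlternatesInSign {n : ℕ} (f : Fin n → ℤ) : Prop :=
  ∀ j k : Fin n, j < k → f j ≠ 0 → f k ≠ 0 → (∀ l, j < l → l < k → f l = 0) → f k = -f j

/-- Alternating sign matrices. -/
structure IsASM {n : ℕ} (A : Matrix (Fin n) (Fin n) ℤ) : Prop where
  entries : ∀ i j, A i j = -1 ∨ A i j = 0 ∨ A i j = 1
  row_alternates : ∀ i, AlternatesInSign (fun j => A i j)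
  col_alternates : ∀ j, AlternatesInSign (fun i => A i j)
  row_sum : ∀ i, ∑ j, A i j = 1
  col_sum : ∀ j, ∑ i, A i j = 1

/-- `R(A)`: the number of nonzero strictly upper triangular entries. -/
def statR {n : ℕ} (A : Matrix (Fin n) (Fin n) ℤ) : ℕ :=
  (Finset.univ.filter fun p : Fin n × Fin n => p.1 < p.2 ∧ A p.1 p.2 ≠ 0).card

/-- `S(A)`: the number of nonzero diagonal entries. -/
def statS {n : ℕ} (A : Matrix (Fin n) (Fin n) ℤ) : ℕ :=
  (Finset.univ.filter fun i : Fin n => A i i ≠ 0).card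

/-- `T(A)`: the (1-based) column index of the `1` in the first row. That a nonempty alternating sign
matrix has exactly one such column is `IsASM.exists_unique_one_first_row` below. -/
noncomputable def statT {n : ℕ} (A : Matrix (Fin n) (Fin n) ℤ) : ℕ :=
  sInf {k : ℕ | ∃ i j : Fin n, (i : ℕ) = 0 ∧ A i j = 1 ∧ k = (j : ℕ) + 1}

/-- The set of diagonally symmetric alternating sign matrices of order `n`. -/
def DSASM (n : ℕ) : Set (Matrix (Fin n) (Fin n) ℤ) :=
  {A | IsASM A ∧ A.transpose = A}

/-- The set of off-diagonally symmetric alternating sign matrices of order `n`: those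
diagonally symmetric ones that have no nonzero diagonal entry if `n` is even, and exactly one if
`n` is odd. -/
def OSASM (n : ℕ) : Set (Matrix (Fin n) (Fin n) ℤ) :=
  {A | A ∈ DSASM n ∧ statS A = if Even n then 0 else 1}

theorem OSASM_finite (n : ℕ) : (OSASM n).Finite := by
  have h : Set.Finite {A : Fin n → Fin n → ℤ | ∀ i, A i ∈ {f : Fin n → ℤ | ∀ j, f j ∈
      ({-1, 0, 1} : Set ℤ)}} :=
    Set.Finite.pi' fun _ => Set.Finite.pi' fun _ => Set.toFinite _
  exact h.subset fun A hA i j => by simpa using hA.1.1.entries i j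

/-- The generating function `X^O_n(r,t) = ∑_{A ∈ OSASM(n)} r^{R(A)} t^{T(A)}`, as an element of
`ℤ[r][t, t⁻¹]`: `r` is the variable `X` of the coefficient ring `ℤ[X]` and `t = T 1`. -/
noncomputable def osasmGenFun (n : ℕ) : ℤ[X][T;T⁻¹] :=
  ∑ A ∈ (OSASM_finite n).toFinset, LaurentPolynomial.C (Polynomial.X : ℤ[X]) ^ statR A *
    LaurentPolynomial.T 1 ^ statT A

theorem AlternatesInSign.tail {n : ℕ} {f : Fin (n + 1) → ℤ} (h : AlternatesInSign f) :
    AlternatesInSign (fun i : Fin n => f i.succ) := by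
  intro j k hjk hj hk hz
  refine h j.succ k.succ (Fin.succ_lt_succ_iff.2 hjk) hj hk fun l h1 h2 => ?_
  obtain ⟨m, rfl⟩ := Fin.exists_succ_eq.2 (Fin.ne_zero_of_lt h1)
  exact hz m (Fin.succ_lt_succ_iff.1 h1) (Fin.succ_lt_succ_iff.1 h2)

theorem AlternatesInSign.sum_le {n : ℕ} (f : Fin n → ℤ) (h : AlternatesInSign f)
    (he : ∀ i, f i = -1 ∨ f i = 0 ∨ f i = 1) :
    ∑ i, f i ≤ 1 ∧ ((∀ k, (∀ j, j < k → f j = 0) → f k ≠ 1) → ∑ i, f i ≤ 0) := by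
  induction n with
  | zero => simp
  | succ n ih =>
    obtain ⟨h1, h2⟩ := ih _ h.tail fun i => he i.succ
    rw [Fin.sum_univ_succ]
    refine ⟨?_, fun hf => ?_⟩
    · rcases he 0 with h0 | h0 | h0
      · omega
      · omega
      · have := h2 fun k hk hk1 => by
          have := h 0 k.succ (Fin.succ_pos k) (by omega) (by simp [hk1]) fun l hl hlk => by
            obtain ⟨m, rfl⟩ := Fin.exists_succ_eq.2 (Fin.ne_zero_of_lt hl)
            exact hk m (Fin.succ_lt_succ_iff.1 hlk)
          omega
        omega
    · rcases he 0 with h0 | h0 | h0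
      · omega
      · have := h2 fun k hk => hf k.succ fun j hj => by
          rcases Fin.eq_zero_or_eq_succ j with rfl | ⟨m, rfl⟩
          · exact h0
          · exact hk m (Fin.succ_lt_succ_iff.1 hj)
        omega
      · exact absurd h0 (hf 0 fun j hj => absurd hj (Fin.not_lt_zero j))

theorem IsASM.exists_unique_one_first_row {n : ℕ} {A : Matrix (Fin n) (Fin n) ℤ} (h : IsASM A)
    (hn : 0 < n) : ∃! j : Fin n, A ⟨0, hn⟩ j = 1 := by
  have hne : ∀ j, A ⟨0, hn⟩ j ≠ -1 := fun j hj => by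
    have := (AlternatesInSign.sum_le _ (h.col_alternates j) fun i => h.entries i j).2
      fun k hk hk1 => by
        by_cases hk0 : (⟨0, hn⟩ : Fin n) < k
        · have := hk _ hk0
          omega
        · have : k = ⟨0, hn⟩ := by
            ext
            simpa [Fin.lt_def] using hk0
          subst this
          omega
    rw [h.col_sum j] at this
    omega
  have hnn : ∀ j, 0 ≤ A ⟨0, hn⟩ j := fun j => by
    rcases h.entries ⟨0, hn⟩ j with h0 | h0 | h0
    · exact absurd h0 (hne j)
    · omega
    · omega
  have hs := h.row_sum ⟨0, hn⟩
  obtain ⟨j, -, hj⟩ : ∃ j ∈ Finset.univ, A ⟨0, hn⟩ j ≠ 0 :=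
    Finset.exists_ne_zero_of_sum_ne_zero (by rw [hs]; decide)
  have hj1 : A ⟨0, hn⟩ j = 1 := by
    rcases h.entries ⟨0, hn⟩ j with h0 | h0 | h0
    · exact absurd h0 (hne j)
    · exact absurd h0 hj
    · exact h0
  refine ⟨j, hj1, fun k hk => ?_⟩
  by_contra hkj
  have := Finset.sum_le_sum_of_subset_of_nonneg (Finset.subset_univ {k, j})
    fun i _ _ => hnn i
  simp only at hk
  rw [Finset.sum_pair hkj, hs] at this
  omega

/-- `statT` is the column index of the `1` in the first row. -/
theorem IsASM.statT_eq {n : ℕ} {A : Matrix (Fin n) (Fin n) ℤ} (h : IsASM A)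
    (hn : 0 < n) (j : Fin n) (hj : A ⟨0, hn⟩ j = 1) : statT A = (j : ℕ) + 1 := by
  have : {k : ℕ | ∃ i j : Fin n, (i : ℕ) = 0 ∧ A i j = 1 ∧ k = (j : ℕ) + 1} = {(j : ℕ) + 1} := by
    ext k
    simp only [Set.mem_ofPred_eq, Set.mem_singleton_iff]
    constructor
    · rintro ⟨i, l, hi, hl, rfl⟩
      have : i = ⟨0, hn⟩ := Fin.ext hi
      subst this
      rw [(h.exists_unique_one_first_row hn).unique hl hj]
    · rintro rfl
      exact ⟨⟨0, hn⟩, j, rfl, hj, rfl⟩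
  rw [statT, this, csInf_singleton]

/-! A symmetric matrix with zero diagonal is determined by its strict upper triangle. Line `i` runs
down column `i` to the diagonal and on along row `i`, carrying the partial sum as a bit; it starts
with `false`, ends with `true`, and every two lines cross once. Nonzero entries are the crossings
that flip both bits, so matrices in OSASM are the states of a six-vertex model on a triangle, and
`r` is the weight of a flip relative to the other weights.

With weights `wtA`, `wtB`, `wtC` the Yang-Baxter equation makes the partition function symmetric in
the spectral parameters (`sixZero_perm`). The key identity (`sixZero_eq_swap`) is that exchanging
the weights `a` and `b` does not change it. Both sides are, up to a factor `x`, polynomials in the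
square of the first parameter `x`, and they agree at the zeros of `wtA`, where two lines freeze and
split off.

With all other parameters 1, the first line flips exactly once; flipping after `k` of `m` crossings
gives `a ^ k * b ^ (m - 1 - k)` times the partition function of the rest. The ratio of `a` to `b` is
free, so comparing coefficients gives the reflection `k ↦ m - 1 - k` for `r = q + 1 / q`, `q > 1`
(`flipSum_unitBits_reflect_real`), hence for indeterminate `r`. This is the reflection of the
position of the 1 in the first row. -/

section TriangularModel

variable {K : Type*} [CommRing K]

/-! ### The triangular vertex model -/

/-- A line with spectral parameter `z` and bit `h` crosses, one after the other, lines with spectral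
parameters `l` and bits `s`. At a crossing, either nothing changes (weight `a` for equal bits, `b`
for different bits) or two equal bits are both flipped (weight `c`). The line has to end with bit
`true`, and `f` is the weight of the bits of the crossed lines afterwards. -/
def crossRow (a b c : K → K) (z : K) : List K → Bool → List Bool → (List Bool → K) → K
  | [], h, _, f => if h then f [] else 0
  | _ :: _, _, [], _ => 0
  | w :: l, h, v :: s, f =>
    if h = v then
      a (z * w) * crossRow a b c z l h s (fun s' => f (v :: s')) +
        c (z * w) * crossRow a b c z l (!h) s (fun s' => f ((!v) :: s'))
    else b (z * w) * crossRow a b c z l h s (fun s' => f (v :: s'))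

/-- The partition function of lines with spectral parameters `l` and initial bits `s`, every two of
which cross once, and which all end with bit `true`. -/
def triSum (a b c : K → K) : List K → List Bool → K
  | [], _ => 1
  | _ :: _, [] => 0
  | z :: l, h :: s => crossRow a b c z l h s (triSum a b c l)

variable {a b c : K → K}

theorem crossRow_add (z : K) (l : List K) (h : Bool) (s : List Bool) (f g : List Bool → K) :
    crossRow a b c z l h s (fun s' => f s' + g s') =
      crossRow a b c z l h s f + crossRow a b c z l h s g := by
  induction l generalizing h s f g with
  | nil => cases h <;> simp [crossRow]
  | cons w l ih =>
    cases s with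
    | nil => simp [crossRow]
    | cons v s =>
      simp only [crossRow, ih]
      split_ifs <;> ring

theorem crossRow_smul (z : K) (l : List K) (h : Bool) (s : List Bool) (r : K) (f : List Bool → K) :
    crossRow a b c z l h s (fun s' => r * f s') = r * crossRow a b c z l h s f := by
  induction l generalizing h s f with
  | nil => cases h <;> simp [crossRow]
  | cons w l ih =>
    cases s with
    | nil => simp [crossRow]
    | cons v s =>
      simp only [crossRow, ih]
      split_ifs <;> ring

theorem crossRow_congr (z : K) (l : List K) (h : Bool) (s : List Bool) {f g : List Bool → K}
    (hfg : ∀ s' : List Bool, s'.length = l.length → f s' = g s') :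
    crossRow a b c z l h s f = crossRow a b c z l h s g := by
  induction l generalizing h s f g with
  | nil => simp [crossRow, hfg []]
  | cons w l ih =>
    cases s with
    | nil => simp [crossRow]
    | cons v s =>
      simp only [crossRow]
      have key : ∀ (e : Bool) (k : Bool), crossRow a b c z l k s (fun s' => f (e :: s')) =
          crossRow a b c z l k s (fun s' => g (e :: s')) := fun e k =>
        ih k s fun s' hs' => hfg (e :: s') (by simp [hs'])
      simp only [key]

/-! ### The Yang-Baxter equation and symmetry in the spectral parameters -/

/-- The action on two bits of the crossing of two parallel neighbouring lines. -/
def exch (α β γ : K) (g : Bool → Bool → K) (b₁ b₂ : Bool) : K :=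
  if b₁ = b₂ then α * g b₁ b₂ else γ * g b₁ b₂ + β * g b₂ b₁

/-- A row that crosses neither of the two exchanged lines acts linearly on the weight of what
remains, so the exchange passes through it. -/
theorem crossRow_exch {α β γ : K} (z : K) (l : List K) (h : Bool) (s : List Bool)
    {f g : Bool → Bool → List Bool → K}
    (hfg : ∀ b₁ b₂ s', exch α β γ (fun x y => f x y s') b₁ b₂ = α * g b₁ b₂ s')
    (b₁ b₂ : Bool) :
    exch α β γ (fun x y => crossRow a b c z l h s (f x y)) b₁ b₂ =
      α * crossRow a b c z l h s (g b₁ b₂) := by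
  have := hfg b₁ b₂
  unfold exch at this ⊢
  split_ifs at this ⊢
  · rw [← crossRow_smul, ← crossRow_smul]
    exact crossRow_congr _ _ _ _ fun s' _ => this s'
  · rw [← crossRow_smul, ← crossRow_smul, ← crossRow_smul, ← crossRow_add]
    exact crossRow_congr _ _ _ _ fun s' _ => this s'

/-- The six-vertex weight of a crossing of two lines with equal bits that stay unchanged, where `u`
is the product of their spectral parameters. -/
def wtA (p q u : K) : K := p * q * (q ^ 2 * u ^ 2 - p ^ 2)
/-- The six-vertex weight of a crossing of two lines with different bits. -/
def wtB (p q u : K) : K := p * q * (q ^ 2 - p ^ 2 * u ^ 2)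
/-- The six-vertex weight of a crossing that flips the bits. -/
def wtC (p q u : K) : K := (q ^ 4 - p ^ 4) * u

/-- The weights of the crossing of two parallel lines. -/
abbrev sixExch (p q z w : K) : (Bool → Bool → K) → Bool → Bool → K :=
  exch (q ^ 4 * w ^ 2 - p ^ 4 * z ^ 2) (p ^ 2 * q ^ 2 * (z ^ 2 - w ^ 2)) ((q ^ 4 - p ^ 4) * (z * w))

abbrev sixRow (p q : K) := crossRow (wtA p q) (wtB p q) (wtC p q)
abbrev sixSum (p q : K) := triSum (wtA p q) (wtB p q) (wtC p q)

/-- Crossing two neighbouring lines before or after a third line has crossed them gives the same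
result: the Yang-Baxter equation. -/
theorem sixRow_exch (p q x z w : K) (P t : List K) (h : Bool) (s₁ s₂ : List Bool)
    (hs : s₁.length = P.length) {f g : List Bool → K}
    (hfg : ∀ (s₁ s₂ : List Bool), s₁.length = P.length → ∀ b₁ b₂,
      sixExch p q z w (fun x y => f (s₁ ++ x :: y :: s₂)) b₁ b₂ =
        (q ^ 4 * w ^ 2 - p ^ 4 * z ^ 2) * g (s₁ ++ b₁ :: b₂ :: s₂)) (b₁ b₂ : Bool) :
    sixExch p q z w (fun y₁ y₂ => sixRow p q x (P ++ z :: w :: t) h (s₁ ++ y₁ :: y₂ :: s₂) f)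
        b₁ b₂ =
      (q ^ 4 * w ^ 2 - p ^ 4 * z ^ 2) *
        sixRow p q x (P ++ w :: z :: t) h (s₁ ++ b₁ :: b₂ :: s₂) g := by
  induction P generalizing h s₁ f g b₁ b₂ with
  | nil =>
    obtain rfl : s₁ = [] := by simpa using hs
    have key := fun h' => crossRow_exch (a := wtA p q) (b := wtB p q) (c := wtC p q) x t h' s₂
      (f := fun x y s => f (x :: y :: s)) (g := fun x y s => g (x :: y :: s))
      (fun b₁ b₂ s' => hfg [] s' rfl b₁ b₂)
    cases h <;> cases b₁ <;> cases b₂ <;> simp only [exch, List.nil_append, sixRow, crossRow]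
    -- In each case `key` enters once for every outcome of the two crossings on the right-hand side,
    -- with the weight of that outcome; what is left is a polynomial identity between weights.
    · linear_combination (norm := skip) wtA p q (x * w) * wtA p q (x * z) * key false false false +
        wtA p q (x * w) * wtC p q (x * z) * key true false true +
        wtC p q (x * w) * wtB p q (x * z) * key true true false
      simp [wtA, wtB, wtC, exch]
      ring
    · linear_combination (norm := skip) wtA p q (x * w) * wtB p q (x * z) * key false false true +
        wtC p q (x * w) * wtA p q (x * z) * key true true true +
        wtC p q (x * w) * wtC p q (x * z) * key false true false
      simp [wtA, wtB, wtC, exch]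
      ring
    · linear_combination (norm := skip) wtB p q (x * w) * wtA p q (x * z) * key false true false +
        wtB p q (x * w) * wtC p q (x * z) * key true true true
      simp [wtA, wtB, wtC, exch]
      ring
    · linear_combination (norm := skip) wtB p q (x * w) * wtB p q (x * z) * key false true true
      simp [wtB, exch]
      ring
    · linear_combination (norm := skip) wtB p q (x * w) * wtB p q (x * z) * key true false false
      simp [wtB, exch]
      ring
    · linear_combination (norm := skip) wtB p q (x * w) * wtA p q (x * z) * key true false true +
        wtB p q (x * w) * wtC p q (x * z) * key false false false
      simp [wtA, wtB, wtC, exch]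
      ring
    · linear_combination (norm := skip) wtA p q (x * w) * wtB p q (x * z) * key true true false +
        wtC p q (x * w) * wtA p q (x * z) * key false false false +
        wtC p q (x * w) * wtC p q (x * z) * key true false true
      simp [wtA, wtB, wtC, exch]
      ring
    · linear_combination (norm := skip) wtA p q (x * w) * wtA p q (x * z) * key true true true +
        wtA p q (x * w) * wtC p q (x * z) * key false true false +
        wtC p q (x * w) * wtB p q (x * z) * key false false true
      simp [wtA, wtB, wtC, exch]
      ring
  | cons y P ih =>
    cases s₁ with
    | nil => simp at hs
    | cons e s₁ =>
      have key := fun k h' => ih h' s₁ (by simpa using hs)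
        (f := fun s => f (k :: s)) (g := fun s => g (k :: s))
        (fun s₁ s₂ hs₁ => hfg (k :: s₁) s₂ (by simp [hs₁])) b₁ b₂
      simp only [List.cons_append, sixRow, crossRow]
      have k1 := key e h
      have k2 := key (!e) (!h)
      simp only [sixExch, exch] at k1 k2 ⊢
      split_ifs at k1 k2 ⊢
      · linear_combination wtA p q (x * y) * k1 + wtC p q (x * y) * k2
      · linear_combination wtB p q (x * y) * k1
      · linear_combination wtA p q (x * y) * k1 + wtC p q (x * y) * k2
      · linear_combination wtB p q (x * y) * k1

/-- Yang-Baxter once more, now with the two exchanged lines crossing all of `t`. The exchange is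
pushed to their ends, where both bits are `true` and it is only a scalar. -/
theorem sixRow_comm_exch (p q z w : K) (t : List K) (s : List Bool) (f : List Bool → K)
    (b₁ b₂ : Bool) :
    sixExch p q z w (fun x y => sixRow p q z t x s (fun s' => sixRow p q w t y s' f)) b₁ b₂ =
      (q ^ 4 * w ^ 2 - p ^ 4 * z ^ 2) *
        sixRow p q w t b₁ s (fun s' => sixRow p q z t b₂ s' f) := by
  induction t generalizing s f b₁ b₂ with
  | nil => cases b₁ <;> cases b₂ <;> simp [exch, crossRow]
  | cons v t ih =>
    cases s with
    | nil => simp [exch, crossRow]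
    | cons e s =>
      have key := fun b₁ b₂ k => ih s (fun s' => f (k :: s')) b₁ b₂
      cases b₁ <;> cases b₂ <;> cases e <;> simp only [exch, sixRow, crossRow]
      · linear_combination (norm := skip) wtA p q (w * v) * wtA p q (z * v) * key false false false +
          wtA p q (w * v) * wtC p q (z * v) * key false true true +
          wtC p q (w * v) * wtB p q (z * v) * key true false true
        simp [wtA, wtB, wtC, exch, crossRow_add, crossRow_smul]
        ring
      · linear_combination (norm := skip) wtB p q (w * v) * wtB p q (z * v) * key false false true
        simp [wtB, exch, crossRow_smul]
        ring
      · linear_combination (norm := skip) wtA p q (w * v) * wtB p q (z * v) * key false true false +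
          wtC p q (w * v) * wtA p q (z * v) * key true true true +
          wtC p q (w * v) * wtC p q (z * v) * key true false false
        simp [wtA, wtB, wtC, exch, crossRow_add, crossRow_smul]
        ring
      · linear_combination (norm := skip) wtB p q (w * v) * wtA p q (z * v) * key false true true +
          wtB p q (w * v) * wtC p q (z * v) * key false false false
        simp [wtA, wtB, wtC, exch, crossRow_add, crossRow_smul]
        ring
      · linear_combination (norm := skip) wtB p q (w * v) * wtA p q (z * v) * key true false false +
          wtB p q (w * v) * wtC p q (z * v) * key true true true
        simp [wtA, wtB, wtC, exch, crossRow_add, crossRow_smul]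
        ring
      · linear_combination (norm := skip) wtA p q (w * v) * wtB p q (z * v) * key true false true +
          wtC p q (w * v) * wtA p q (z * v) * key false false false +
          wtC p q (w * v) * wtC p q (z * v) * key false true true
        simp [wtA, wtB, wtC, exch, crossRow_add, crossRow_smul]
        ring
      · linear_combination (norm := skip) wtB p q (w * v) * wtB p q (z * v) * key true true false
        simp [wtB, exch, crossRow_smul]
        ring
      · linear_combination (norm := skip) wtA p q (w * v) * wtA p q (z * v) * key true true true +
          wtA p q (w * v) * wtC p q (z * v) * key true false false +
          wtC p q (w * v) * wtB p q (z * v) * key false true false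
        simp [wtA, wtB, wtC, exch, crossRow_add, crossRow_smul]
        ring

/-- Earlier lines let the exchange through by `sixRow_exch`. When its two lines come first, they
also cross each other: that crossing is scalar on different bits and the exchange is scalar on equal
bits, so the two commute. -/
theorem sixSum_exch (p q z w : K) (P t : List K) (s₁ s₂ : List Bool)
    (hs : s₁.length = P.length) (b₁ b₂ : Bool) :
    sixExch p q z w (fun x y => sixSum p q (P ++ z :: w :: t) (s₁ ++ x :: y :: s₂)) b₁ b₂ =
      (q ^ 4 * w ^ 2 - p ^ 4 * z ^ 2) *
        sixSum p q (P ++ w :: z :: t) (s₁ ++ b₁ :: b₂ :: s₂) := by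
  induction P generalizing s₁ s₂ b₁ b₂ with
  | nil =>
    obtain rfl : s₁ = [] := by simpa using hs
    have key := sixRow_comm_exch p q z w t s₂ (sixSum p q t)
    have comm : wtA p q (z * w) = wtA p q (w * z) ∧ wtB p q (z * w) = wtB p q (w * z) ∧
        wtC p q (z * w) = wtC p q (w * z) := by simp [mul_comm]
    obtain ⟨hA, hB, hC⟩ := comm
    cases b₁ <;> cases b₂ <;> simp only [exch, List.nil_append, sixSum, triSum, crossRow]
    · linear_combination (norm := skip) wtA p q (z * w) * key false false +
        wtC p q (z * w) * key true true
      simp [exch, hA, hC]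
      ring
    · linear_combination (norm := skip) wtB p q (z * w) * key false true
      simp [exch, hB]
      ring
    · linear_combination (norm := skip) wtB p q (z * w) * key true false
      simp [exch, hB]
      ring
    · linear_combination (norm := skip) wtA p q (z * w) * key true true +
        wtC p q (z * w) * key false false
      simp [exch, hA, hC]
      ring
  | cons x P ih =>
    cases s₁ with
    | nil => simp at hs
    | cons e s₁ =>
      exact sixRow_exch p q x z w P t e s₁ s₂ (by simpa using hs)
        (fun s₁ s₂ hs₁ b₁ b₂ => ih s₁ s₂ hs₁ b₁ b₂) b₁ b₂

/-- The partition function for initial bits `false`. -/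
abbrev sixZero (p q : K) (l : List K) : K := sixSum p q l (List.replicate l.length false)

theorem sixZero_swap (p q z w : K) (P t : List K) :
    (q ^ 4 * w ^ 2 - p ^ 4 * z ^ 2) * sixZero p q (P ++ z :: w :: t) =
      (q ^ 4 * w ^ 2 - p ^ 4 * z ^ 2) * sixZero p q (P ++ w :: z :: t) := by
  have h := sixSum_exch p q z w P t (List.replicate P.length false)
    (List.replicate t.length false) (by simp) false false
  have e : ∀ x y : K, List.replicate (P ++ x :: y :: t).length false =
      List.replicate P.length false ++ false :: false :: List.replicate t.length false := by
    intro x y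
    simp [List.replicate_add, List.replicate_succ]
  simpa only [sixZero, e, exch, if_true] using h

theorem sixZero_perm [IsDomain K] (p q : K) {l₁ l₂ : List K} (h : l₁.Perm l₂) (P : List K)
    (hl : ∀ z ∈ l₁, ∀ w ∈ l₁, q ^ 4 * w ^ 2 ≠ p ^ 4 * z ^ 2) :
    sixZero p q (P ++ l₁) = sixZero p q (P ++ l₂) := by
  induction h generalizing P with
  | nil => rfl
  | cons x h ih =>
    have := ih (P ++ [x]) fun z hz w hw => hl z (by simp [hz]) w (by simp [hw])
    simpa using this
  | swap x y l =>
    exact mul_left_cancel₀ (sub_ne_zero.2 (hl y (by simp) x (by simp))) (sixZero_swap p q y x P l)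
  | trans h₁ h₂ ih₁ ih₂ =>
    exact (ih₁ P hl).trans (ih₂ P fun z hz w hw => hl z (h₁.mem_iff.2 hz) w (h₁.mem_iff.2 hw))

/-! ### Frozen lines at the zeros of a weight -/

theorem crossRow_true_replicate_false (z : K) (l : List K) (f : List Bool → K) :
    crossRow a b c z l true (List.replicate l.length false) f =
      (l.map fun w => b (z * w)).prod * f (List.replicate l.length false) := by
  induction l generalizing f with
  | nil => simp [crossRow]
  | cons w l ih => simp [crossRow, List.replicate_succ, ih, mul_assoc]

/-- The line must end with `true`, so at the last crossing, where it meets a `true`, it can only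
arrive with `true` and leave both bits unchanged. -/
theorem crossRow_concat_true (z y : K) (l : List K) (h : Bool) (s : List Bool)
    (hs : s.length = l.length) (r : K) (f g : List Bool → K)
    (hfg : ∀ s', s'.length = l.length → f (s' ++ [true]) = r * g s') :
    crossRow a b c z (l ++ [y]) h (s ++ [true]) f =
      a (z * y) * r * crossRow a b c z l h s g := by
  induction l generalizing h s f g with
  | nil =>
    obtain rfl : s = [] := by simpa using hs
    have := hfg [] rfl
    cases h <;> simp_all [crossRow, mul_assoc]
  | cons w l ih =>
    cases s with
    | nil => simp at hs
    | cons v s =>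
      have key := fun h' k => ih h' s (by simpa using hs) (fun s' => f (k :: s'))
        (fun s' => g (k :: s')) (fun s' hs' => hfg (k :: s') (by simp [hs']))
      simp only [List.cons_append, crossRow, key]
      split_ifs <;> ring

theorem triSum_concat_true (y : K) (l : List K) (s : List Bool) (hs : s.length = l.length) :
    triSum a b c (l ++ [y]) (s ++ [true]) =
      (l.map fun w => a (w * y)).prod * triSum a b c l s := by
  induction l generalizing s with
  | nil =>
    obtain rfl : s = [] := by simpa using hs
    simp [triSum, crossRow]
  | cons w l ih =>
    cases s with
    | nil => simp at hs
    | cons v s =>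
      simp only [List.cons_append, triSum, List.map_cons, List.prod_cons]
      exact crossRow_concat_true _ _ _ _ _ (by simpa using hs) _ _ _ ih

/-- The first crossing is forced to flip. Both lines then carry `true` among lines with `false`, so
all their other crossings have weight `b`. -/
theorem triSum_of_head_eq_zero (x y : K) (l : List K) (h : a (x * y) = 0) :
    triSum a b c (x :: y :: l) (List.replicate (l.length + 2) false) =
      c (x * y) * (l.map fun w => b (x * w)).prod * (l.map fun w => b (y * w)).prod *
        triSum a b c l (List.replicate l.length false) := by
  simp [List.replicate_succ, triSum, crossRow, h, crossRow_true_replicate_false, mul_assoc]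

/-- Had the line flipped earlier, it would reach `y` with `true` against `false`, a crossing of
weight 0. -/
theorem crossRow_of_last_eq_zero (x y : K) (l : List K) (h : b (x * y) = 0)
    (f : List Bool → K) :
    crossRow a b c x (l ++ [y]) false (List.replicate (l.length + 1) false) f =
      (l.map fun w => a (x * w)).prod * c (x * y) * f (List.replicate l.length false ++ [true]) := by
  induction l generalizing f with
  | nil => simp [crossRow]
  | cons w l ih =>
    have e : (l ++ [y]).length = l.length + 1 := by simp
    have := crossRow_true_replicate_false (a := a) (b := b) (c := c) x (l ++ [y])
      (fun s' => f (true :: s'))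
    rw [e] at this
    rw [List.length_cons, List.replicate_succ, List.cons_append, crossRow, if_pos rfl, ih,
      Bool.not_false, this]
    simp [h, List.replicate_succ, mul_assoc]

theorem triSum_of_last_eq_zero (x y : K) (l : List K) (h : b (x * y) = 0) :
    triSum a b c (x :: (l ++ [y])) (List.replicate (l.length + 2) false) =
      c (x * y) * (l.map fun w => a (x * w)).prod * (l.map fun w => a (w * y)).prod *
        triSum a b c l (List.replicate l.length false) := by
  rw [List.replicate_succ, triSum, crossRow_of_last_eq_zero _ _ _ h,
    triSum_concat_true _ _ _ (by simp)]
  ring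

/-! ### Rescaling weights, ring homomorphisms, polynomiality in one parameter -/

theorem crossRow_smul_weights (r z : K) (l : List K) (h : Bool) (s : List Bool)
    (f : List Bool → K) :
    crossRow (fun u => r * a u) (fun u => r * b u) (fun u => r * c u) z l h s f =
      r ^ l.length * crossRow a b c z l h s f := by
  induction l generalizing h s f with
  | nil => simp [crossRow]
  | cons w l ih =>
    cases s with
    | nil => simp [crossRow]
    | cons v s =>
      simp only [crossRow, ih, List.length_cons]
      split_ifs <;> ring

theorem triSum_smul_weights (r : K) (l : List K) (s : List Bool) :
    triSum (fun u => r * a u) (fun u => r * b u) (fun u => r * c u) l s =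
      r ^ (l.length.choose 2) * triSum a b c l s := by
  induction l generalizing s with
  | nil => simp [triSum]
  | cons w l ih =>
    cases s with
    | nil => simp [triSum]
    | cons v s =>
      rw [triSum, crossRow_smul_weights, crossRow_congr _ _ _ _ fun s' _ => ih s', crossRow_smul,
        triSum, List.length_cons, Nat.choose_succ_succ' l.length 1, Nat.choose_one_right, pow_add]
      ring

theorem map_crossRow {L : Type*} [CommRing L] (φ : K →+* L) {a' b' c' : L → L}
    (ha : ∀ u, φ (a u) = a' (φ u)) (hb : ∀ u, φ (b u) = b' (φ u)) (hc : ∀ u, φ (c u) = c' (φ u))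
    (z : K) (l : List K) (h : Bool) (s : List Bool) (f : List Bool → K) :
    φ (crossRow a b c z l h s f) = crossRow a' b' c' (φ z) (l.map φ) h s (fun s' => φ (f s')) := by
  induction l generalizing h s f with
  | nil => cases h <;> simp [crossRow]
  | cons w l ih =>
    cases s with
    | nil => simp [crossRow]
    | cons v s =>
      simp only [crossRow, List.map_cons]
      split_ifs <;> simp [ih, ha, hb, hc]

theorem map_triSum {L : Type*} [CommRing L] (φ : K →+* L) {a' b' c' : L → L}
    (ha : ∀ u, φ (a u) = a' (φ u)) (hb : ∀ u, φ (b u) = b' (φ u)) (hc : ∀ u, φ (c u) = c' (φ u))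
    (l : List K) (s : List Bool) :
    φ (triSum a b c l s) = triSum a' b' c' (l.map φ) s := by
  induction l generalizing s with
  | nil => simp [triSum]
  | cons w l ih =>
    cases s with
    | nil => simp [triSum]
    | cons v s =>
      rw [triSum, map_crossRow φ ha hb hc, List.map_cons, triSum]
      exact crossRow_congr _ _ _ _ fun s' _ => ih s'

/-- As a function of the spectral parameter of the first line, the partition function is an odd
polynomial of bounded degree. -/
theorem exists_polynomial_crossRow [Nontrivial K] {a₀ a₁ b₀ b₁ c₁ : K}
    (ha : ∀ u, a u = a₀ + a₁ * u ^ 2) (hb : ∀ u, b u = b₀ + b₁ * u ^ 2) (hc : ∀ u, c u = c₁ * u)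
    (l : List K) (f : List Bool → K) :
    ∃ P : K[X], P.degree < l.length ∧ ∀ x,
      crossRow a b c x l false (List.replicate l.length false) f = x * P.eval (x ^ 2) := by
  have hprod : ∀ l : List K, ∃ P : K[X], P.degree ≤ l.length ∧
      ∀ x, (l.map fun w => b (x * w)).prod = P.eval (x ^ 2) := by
    intro l
    induction l with
    | nil => exact ⟨1, by simp, by simp⟩
    | cons w l ih =>
      obtain ⟨P, hP, hP'⟩ := ih
      refine ⟨(Polynomial.C (b₁ * w ^ 2) * Polynomial.X + Polynomial.C b₀) * P, ?_, ?_⟩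
      · refine (Polynomial.degree_mul_le _ _).trans ?_
        rw [List.length_cons, Nat.cast_succ, add_comm]
        exact add_le_add hP Polynomial.degree_linear_le
      · intro x
        rw [List.map_cons, List.prod_cons, hP', hb]
        simp
        ring
  induction l generalizing f with
  | nil => exact ⟨0, by simp, by simp [crossRow]⟩
  | cons w l ih =>
    obtain ⟨P, hP, hP'⟩ := ih (fun s' => f (false :: s'))
    obtain ⟨Q, hQ, hQ'⟩ := hprod l
    -- Either the first crossing leaves the bits alone, or it flips them and every later crossing
    -- has weight `b`. So `c`, the only odd factor, occurs exactly once.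
    refine ⟨(Polynomial.C (a₁ * w ^ 2) * Polynomial.X + Polynomial.C a₀) * P +
      Polynomial.C (c₁ * w * f (true :: List.replicate l.length false)) * Q, ?_, ?_⟩
    · refine (Polynomial.degree_add_le _ _).trans_lt (max_lt ?_ ?_)
      · rcases eq_or_ne P 0 with rfl | hP0
        · simp [WithBot.bot_lt_iff_ne_bot]
        refine (Polynomial.degree_mul_le _ _).trans_lt ?_
        rw [List.length_cons, Polynomial.degree_eq_natDegree hP0] at *
        have h1 := (Polynomial.natDegree_lt_iff_degree_lt hP0).2
          (by rwa [Polynomial.degree_eq_natDegree hP0])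
        calc _ ≤ (1 : WithBot ℕ) + P.natDegree := by
              gcongr
              exact Polynomial.degree_linear_le
          _ < _ := by
              norm_cast
              omega
      · refine ((Polynomial.degree_mul_le _ _).trans
          (add_le_add Polynomial.degree_C_le hQ)).trans_lt ?_
        rw [List.length_cons, zero_add]
        norm_cast
        omega
    · intro x
      rw [List.length_cons, List.replicate_succ, crossRow, if_pos rfl, hP', Bool.not_false,
        crossRow_true_replicate_false, hQ', ha, hc]
      simp
      ring

/-! ### Invariance under exchange of the weights `a` and `b` -/

/-- Exchanging `p` and `q` turns the weights `a`, `b`, `c` into `-b`, `-a`, `-c`, so the swapped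
model is again a six-vertex model and inherits the symmetry. The sign counts the crossings. -/
theorem triSum_swap_weights {K : Type*} [CommRing K] (p q : K) (l : List K) (s : List Bool) :
    triSum (wtB p q) (wtA p q) (wtC p q) l s = (-1) ^ (l.length.choose 2) * sixSum q p l s := by
  rw [sixSum, ← triSum_smul_weights]
  congr 1 <;> funext u <;> simp only [wtA, wtB, wtC] <;> ring

theorem triSum_swap_weights_perm {K : Type*} [CommRing K] [IsDomain K] (p q x : K) {l₁ l₂ : List K}
    (h : l₁.Perm l₂) (hl : ∀ z ∈ l₁, ∀ w ∈ l₁, p ^ 4 * w ^ 2 ≠ q ^ 4 * z ^ 2) :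
    triSum (wtB p q) (wtA p q) (wtC p q) (x :: l₁) (List.replicate (l₁.length + 1) false) =
      triSum (wtB p q) (wtA p q) (wtC p q) (x :: l₂) (List.replicate (l₂.length + 1) false) := by
  rw [triSum_swap_weights, triSum_swap_weights, List.length_cons, List.length_cons, h.length_eq]
  have := sixZero_perm q p h [x] hl
  simp only [sixZero, List.singleton_append, List.length_cons, h.length_eq] at this
  rw [this]

/-- Lagrange interpolation in `x ^ 2`: there are as many nodes as lines in `l`, one more than the
degree can reach. At each node both sides reduce to the same product times the statement for two
lines fewer. -/
theorem sixZero_eq_swap_of_nodup {q : ℝ} (hq : 1 < q) (n : ℕ) (l : List ℝ) (hn : l.length = n)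
    (hd : l.Nodup) (hl : ∀ z ∈ l, 1 ≤ z ∧ z ≤ q) (x : ℝ) :
    triSum (wtA 1 q) (wtB 1 q) (wtC 1 q) (x :: l) (List.replicate (n + 1) false) =
      triSum (wtB 1 q) (wtA 1 q) (wtC 1 q) (x :: l) (List.replicate (n + 1) false) := by
  induction n using Nat.strong_induction_on generalizing l x with
  | _ n ih =>
  -- Confining the parameters to `[1, q]` keeps the factors cancelled in the permutation lemmas
  -- nonzero, for both orders of the weights.
  have hne : ∀ z ∈ l, ∀ w ∈ l, z ^ 2 < q ^ 4 * w ^ 2 := by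
    intro z hz w hw
    have h1 := hl z hz
    have h2 := hl w hw
    calc z ^ 2 ≤ q ^ 2 := by gcongr <;> linarith
      _ < q ^ 4 := by gcongr; norm_num
      _ ≤ q ^ 4 * w ^ 2 := le_mul_of_one_le_right (by positivity) (one_le_pow₀ h2.1)
  obtain ⟨P, hP, hP'⟩ := exists_polynomial_crossRow (K := ℝ) (a := wtA 1 q) (b := wtB 1 q)
    (c := wtC 1 q) (a₀ := -q) (a₁ := q ^ 3) (b₀ := q ^ 3) (b₁ := -q) (c₁ := q ^ 4 - 1)
    (by intro u; simp only [wtA]; ring) (by intro u; simp only [wtB]; ring)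
    (by intro u; simp only [wtC]; ring) l (triSum (wtA 1 q) (wtB 1 q) (wtC 1 q) l)
  obtain ⟨Q, hQ, hQ'⟩ := exists_polynomial_crossRow (K := ℝ) (a := wtB 1 q) (b := wtA 1 q)
    (c := wtC 1 q) (b₀ := -q) (b₁ := q ^ 3) (a₀ := q ^ 3) (a₁ := -q) (c₁ := q ^ 4 - 1)
    (by intro u; simp only [wtB]; ring) (by intro u; simp only [wtA]; ring)
    (by intro u; simp only [wtC]; ring) l (triSum (wtB 1 q) (wtA 1 q) (wtC 1 q) l)
  have node : ∀ y ∈ l, ∀ x, x = 1 / (q * y) →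
      triSum (wtA 1 q) (wtB 1 q) (wtC 1 q) (x :: l) (List.replicate (n + 1) false) =
        triSum (wtB 1 q) (wtA 1 q) (wtC 1 q) (x :: l) (List.replicate (n + 1) false) := by
    intro y hy x hx
    have hy0 : y ≠ 0 := by linarith [(hl y hy).1]
    have hA : wtA 1 q (x * y) = 0 := by
      rw [wtA, hx]
      field_simp
      ring
    -- At the node `wtA` vanishes. It is the first weight on the left, so `y` is moved next to `x`;
    -- it is the second weight on the right, so `y` is moved to the end.
    set t := l.erase y with ht
    have hp : l.Perm (y :: t) := List.perm_cons_erase hy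
    have hp' : l.Perm (t ++ [y]) := hp.trans (List.perm_append_singleton y t).symm
    have hlen : n = t.length + 1 := by rw [← hn, hp.length_eq, List.length_cons]
    have hZ : triSum (wtA 1 q) (wtB 1 q) (wtC 1 q) t (List.replicate t.length false) =
        triSum (wtB 1 q) (wtA 1 q) (wtC 1 q) t (List.replicate t.length false) := by
      have htd : t.Nodup := hd.erase y
      have htl : ∀ z ∈ t, 1 ≤ z ∧ z ≤ q := fun z hz => hl z (List.mem_of_mem_erase hz)
      clear_value t
      cases t with
      | nil => simp [triSum]
      | cons y' t =>
        exact ih t.length (by simp at hlen; omega) t rfl (List.nodup_cons.1 htd).2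
          (fun z hz => htl z (by simp [hz])) y'
    have h1 := sixZero_perm 1 q hp [x] fun z hz w hw => by simpa using (hne z hz w hw).ne'
    have h2 := triSum_swap_weights_perm 1 q x hp' fun z hz w hw => by
      simpa using (hne w hw z hz).ne
    simp only [sixZero, sixSum, List.singleton_append, List.length_cons, hp.length_eq] at h1
    simp only [hp'.length_eq, List.length_append, List.length_singleton] at h2
    rw [hlen]
    refine h1.trans (Eq.trans ?_ h2.symm)
    rw [triSum_of_head_eq_zero _ _ _ hA, triSum_of_last_eq_zero _ _ _ hA, hZ]
    simp only [mul_comm _ y]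
  have hPQ : P = Q := by
    refine Polynomial.eq_of_degrees_lt_of_eval_index_eq (s := l.toFinset)
      (v := fun y => (1 / (q * y)) ^ 2) ?_ ?_ ?_ ?_
    · intro y hy z hz hyz
      have h1 := hl y (by simpa using hy)
      have h2 := hl z (by simpa using hz)
      have h3 : 1 / (q * y) = 1 / (q * z) := by
        refine (pow_left_inj₀ ?_ ?_ two_ne_zero).1 hyz
        · have := h1.1; positivity
        · have := h2.1; positivity
      simpa [show q ≠ 0 by linarith] using h3
    · rwa [List.toFinset_card_of_nodup hd]
    · rwa [List.toFinset_card_of_nodup hd]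
    · intro y hy
      have hy' : y ∈ l := by simpa using hy
      have h := node y hy' _ rfl
      rw [List.replicate_succ, triSum, triSum, ← hn, hP', hQ'] at h
      have hy0 : 0 < y := by linarith [(hl y hy').1]
      exact mul_left_cancel₀ (by positivity) h
  rw [List.replicate_succ, triSum, triSum, ← hn, hP', hQ', hPQ]

/-- The partition function with one free spectral parameter is invariant under its inversion, which
exchanges the weights `a` and `b`. -/
theorem sixZero_eq_swap {q : ℝ} (hq : 1 < q) (n : ℕ) (x : ℝ) :
    triSum (wtA 1 q) (wtB 1 q) (wtC 1 q) (x :: List.replicate n 1)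
        (List.replicate (n + 1) false) =
      triSum (wtB 1 q) (wtA 1 q) (wtC 1 q) (x :: List.replicate n 1)
        (List.replicate (n + 1) false) := by
  -- The equal parameters are perturbed to `1 + i * ε`, which are distinct and in `[1, q]` for small
  -- `ε > 0`. The difference is a polynomial in `ε`, so it also vanishes at `ε = 0`.
  let L : List ℝ[X] := Polynomial.C x ::
    (List.range n).map fun i : ℕ => 1 + ((i : ℕ) : ℝ[X]) * Polynomial.X
  let Q : ℝ[X] := Polynomial.C q
  let s := List.replicate (n + 1) false
  let D : ℝ[X] := triSum (wtA 1 Q) (wtB 1 Q) (wtC 1 Q) L s - triSum (wtB 1 Q) (wtA 1 Q) (wtC 1 Q) L s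
  have hD : ∀ ε : ℝ, D.eval ε =
      triSum (wtA 1 q) (wtB 1 q) (wtC 1 q) (x :: (List.range n).map fun i : ℕ => 1 + (i : ℝ) * ε) s -
      triSum (wtB 1 q) (wtA 1 q) (wtC 1 q) (x :: (List.range n).map fun i : ℕ => 1 + (i : ℝ) * ε) s := by
    intro ε
    have hA : ∀ u : ℝ[X], Polynomial.evalRingHom ε (wtA 1 Q u) =
      wtA 1 q (Polynomial.evalRingHom ε u) := fun u => by simp [wtA, Q]
    have hB : ∀ u : ℝ[X], Polynomial.evalRingHom ε (wtB 1 Q u) =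
      wtB 1 q (Polynomial.evalRingHom ε u) := fun u => by simp [wtB, Q]
    have hC : ∀ u : ℝ[X], Polynomial.evalRingHom ε (wtC 1 Q u) =
      wtC 1 q (Polynomial.evalRingHom ε u) := fun u => by simp [wtC, Q]
    have hL : L.map (Polynomial.evalRingHom ε) =
        x :: (List.range n).map fun i : ℕ => 1 + (i : ℝ) * ε := by
      simp [L, Function.comp_def]
    rw [← Polynomial.coe_evalRingHom, map_sub, map_triSum _ hA hB hC, map_triSum _ hB hA hC, hL]
  have hD0 : D = 0 := by
    refine Polynomial.eq_zero_of_infinite_isRoot _ (Set.Infinite.mono ?_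
      (Set.Ioo_infinite (show 0 < (q - 1) / (n + 1) by
        have : 0 < q - 1 := by linarith
        positivity)))
    intro ε hε
    rw [Set.mem_ofPred_eq, Polynomial.IsRoot, hD, sub_eq_zero]
    refine sixZero_eq_swap_of_nodup hq n _ (by simp) ?_ ?_ x
    · refine List.Nodup.map ?_ List.nodup_range
      intro i j hij
      simpa [hε.1.ne'] using hij
    · intro z hz
      obtain ⟨i, hi, rfl⟩ := List.mem_map.1 hz
      have hi' : (i : ℝ) ≤ n + 1 := by
        have : i < n := by simpa using hi
        exact_mod_cast (by omega : i ≤ n + 1)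
      have h1 := hε.1
      have h2 : (n + 1 : ℝ) * ε < q - 1 := by
        have := (lt_div_iff₀ (by positivity)).1 hε.2
        linarith
      have h3 : (i : ℝ) * ε ≤ (n + 1) * ε := by gcongr
      have h4 : 0 ≤ (i : ℝ) * ε := by positivity
      constructor <;> linarith
  have := hD 0
  rw [hD0, Polynomial.eval_zero, eq_comm, sub_eq_zero] at this
  simpa [s] using this

/-! ### Extraction of the position of the first flip -/

/-- The bits that are `false` except at position `k`. -/
def unitBits (m k : ℕ) : List Bool := List.ofFn fun i : Fin m => decide ((i : ℕ) = k)

theorem unitBits_succ_zero (m : ℕ) : unitBits (m + 1) 0 = true :: List.replicate m false := by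
  simp [unitBits, List.ofFn_succ, List.ofFn_const]

theorem unitBits_succ_succ (m k : ℕ) : unitBits (m + 1) (k + 1) = false :: unitBits m k := by
  simp [unitBits, List.ofFn_succ]

/-- The line flips at exactly one crossing `k`: before it all bits are equal (weight `a`), after it
they differ (weight `b`). -/
theorem crossRow_replicate_one {K : Type*} [CommRing K] {a b c : K → K} (x : K) (m : ℕ)
    (f : List Bool → K) :
    crossRow a b c x (List.replicate m 1) false (List.replicate m false) f =
      ∑ k ∈ Finset.range m, a x ^ k * b x ^ (m - 1 - k) * (c x * f (unitBits m k)) := by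
  induction m generalizing f with
  | zero => simp [crossRow]
  | succ m ih =>
    have h := crossRow_true_replicate_false (a := a) (b := b) (c := c) x (List.replicate m 1)
      (fun s' => f (true :: s'))
    rw [List.length_replicate] at h
    rw [List.replicate_succ, List.replicate_succ, crossRow, if_pos rfl, ih, Bool.not_false, h,
      Finset.sum_range_succ', Finset.mul_sum]
    congr 1
    · refine Finset.sum_congr rfl fun k hk => ?_
      rw [unitBits_succ_succ, show m + 1 - 1 - (k + 1) = m - 1 - k by omega]
      ring_nf
    · simp [unitBits_succ_zero]
      ring

theorem triSum_replicate_one {K : Type*} [CommRing K] (a b c : K → K) (m : ℕ) (s : List Bool) :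
    triSum a b c (List.replicate m 1) s =
      triSum (fun _ => a 1) (fun _ => b 1) (fun _ => c 1) (List.replicate m 1) s := by
  have row : ∀ (m : ℕ) (h : Bool) (s : List Bool) (f : List Bool → K),
      crossRow a b c 1 (List.replicate m 1) h s f =
        crossRow (fun _ => a 1) (fun _ => b 1) (fun _ => c 1) 1 (List.replicate m 1) h s f := by
    intro m
    induction m with
    | zero => simp [crossRow]
    | succ m ih =>
      intro h s f
      cases s <;> simp [List.replicate_succ, crossRow, ih]
  induction m generalizing s with
  | zero => simp [triSum]
  | succ m ih =>
    cases s with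
    | nil => simp [List.replicate_succ, triSum]
    | cons h s =>
      rw [List.replicate_succ, triSum, triSum, row]
      exact crossRow_congr _ _ _ _ fun s' _ => ih s'

/-- The partition function in which every flip has weight `r` and everything else weight `1`. -/
def flipSum {K : Type*} [CommRing K] (r : K) (m : ℕ) (s : List Bool) : K :=
  triSum (fun _ => 1) (fun _ => 1) (fun _ => r) (List.replicate m 1) s

theorem map_flipSum {K L : Type*} [CommRing K] [CommRing L] (φ : K →+* L) (r : K) (m : ℕ)
    (s : List Bool) : φ (flipSum r m s) = flipSum (φ r) m s := by
  rw [flipSum, map_triSum φ (a' := fun _ => 1) (b' := fun _ => 1) (c' := fun _ => φ r) (by simp)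
    (by simp) (by simp), List.map_replicate, map_one]
  rfl

theorem flipSum_unitBits_reflect_real {q : ℝ} (hq : 1 < q) (m k : ℕ) (hk : k < m) :
    flipSum (q + 1 / q) m (unitBits m k) = flipSum (q + 1 / q) m (unitBits m (m - 1 - k)) := by
  let F : ℕ → ℝ := fun k => flipSum (q + 1 / q) m (unitBits m k)
  have hq2 : 1 < q ^ 2 := one_lt_pow₀ hq two_ne_zero
  have hq4 : 1 < q ^ 4 := one_lt_pow₀ hq four_ne_zero
  have hg : 0 < q * (q ^ 2 - 1) := mul_pos (by linarith) (by linarith)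
  -- At parameter 1 the weights are `1`, `1`, `q + 1 / q` up to a common factor.
  have hA1 : wtA 1 q 1 = q * (q ^ 2 - 1) * 1 := by simp [wtA]
  have hB1 : wtB 1 q 1 = q * (q ^ 2 - 1) * 1 := by simp [wtB]
  have hC1 : wtC 1 q 1 = q * (q ^ 2 - 1) * (q + 1 / q) := by
    simp only [wtC]
    field_simp
    ring
  have hF : ∀ s, triSum (wtA 1 q) (wtB 1 q) (wtC 1 q) (List.replicate m 1) s =
      (q * (q ^ 2 - 1)) ^ (m.choose 2) * flipSum (q + 1 / q) m s := by
    intro s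
    rw [triSum_replicate_one, hA1, hB1, hC1]
    simpa [flipSum] using triSum_smul_weights (a := fun _ => 1) (b := fun _ => 1) (c := fun _ => q + 1 / q)
      (q * (q ^ 2 - 1)) (List.replicate m 1) s
  have hF' : ∀ s, triSum (wtB 1 q) (wtA 1 q) (wtC 1 q) (List.replicate m 1) s =
      (q * (q ^ 2 - 1)) ^ (m.choose 2) * flipSum (q + 1 / q) m s := by
    intro s
    rw [← hF, triSum_replicate_one, triSum_replicate_one (wtA 1 q), hA1, hB1]
  let D : ℝ[X] := ∑ j ∈ Finset.range m, Polynomial.C (F j - F (m - 1 - j)) * Polynomial.X ^ j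
  have hD : D = 0 := by
    refine Polynomial.eq_zero_of_infinite_isRoot _ (Set.Infinite.mono ?_ (Set.Ioi_infinite (0 : ℝ)))
    intro t ht
    have ht : 0 < t := ht
    -- This `x` solves `wtA 1 q x = t * wtB 1 q x`, so the ratio of the two weights takes every
    -- positive value.
    let x := √((t * q ^ 2 + 1) / (q ^ 2 + t))
    have hx : x ^ 2 = (t * q ^ 2 + 1) / (q ^ 2 + t) := Real.sq_sqrt (by positivity)
    have hx0 : 0 < x := Real.sqrt_pos.2 (by positivity)
    have hB : wtB 1 q x = q * (q ^ 4 - 1) / (q ^ 2 + t) := by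
      simp only [wtB, hx]
      field_simp
      ring
    have hA : wtA 1 q x = t * wtB 1 q x := by
      simp only [wtA, hB, hx]
      field_simp
      ring
    have hB0 : wtB 1 q x ≠ 0 := by
      rw [hB]
      have : 0 < q ^ 4 - 1 := by linarith
      positivity
    have hC0 : wtC 1 q x ≠ 0 := by
      simp only [wtC, one_pow]
      have : 0 < q ^ 4 - 1 := by linarith
      positivity
    have key := sixZero_eq_swap hq m x
    rw [List.replicate_succ, triSum, triSum, crossRow_replicate_one, crossRow_replicate_one] at key
    simp only [hF, hF'] at key
    rw [← Finset.sum_range_reflect (fun k => wtB 1 q x ^ k * _ * _), ← sub_eq_zero,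
      ← Finset.sum_sub_distrib] at key
    rw [Set.mem_ofPred_eq, Polynomial.IsRoot, Polynomial.eval_finsetSum]
    have hne : wtB 1 q x ^ (m - 1) * wtC 1 q x * (q * (q ^ 2 - 1)) ^ (m.choose 2) ≠ 0 := by
      have := hg.ne'
      positivity
    refine (mul_eq_zero_iff_left hne).1 ?_
    rw [Finset.mul_sum, ← key]
    refine Finset.sum_congr rfl fun j hj => ?_
    have hj' : j < m := Finset.mem_range.1 hj
    rw [show m - 1 - (m - 1 - j) = j by omega, hA, mul_pow]
    simp only [Polynomial.eval_mul, Polynomial.eval_C, Polynomial.eval_pow, Polynomial.eval_X, F]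
    have : wtB 1 q x ^ (m - 1) = wtB 1 q x ^ j * wtB 1 q x ^ (m - 1 - j) := by
      rw [← pow_add]
      congr 1
      omega
    rw [this]
    ring
  have := congrArg (fun P => Polynomial.coeff P k) hD
  simp only [D, Polynomial.finsetSum_coeff, Polynomial.coeff_C_mul, Polynomial.coeff_X_pow,
    Polynomial.coeff_zero] at this
  have hFk : F k = F (m - 1 - k) := by simpa [hk, sub_eq_zero] using this
  exact hFk

/-- Both sides are polynomials in `r` that agree at the infinitely many values `q + 1 / q` with `q >
1`. -/
theorem flipSum_unitBits_reflect (m k : ℕ) (hk : k < m) :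
    flipSum (Polynomial.X : ℤ[X]) m (unitBits m k) =
      flipSum Polynomial.X m (unitBits m (m - 1 - k)) := by
  refine Polynomial.map_injective (Int.castRingHom ℝ) Int.cast_injective ?_
  refine Polynomial.eq_of_infinite_eval_eq _ _ (Set.Infinite.mono ?_
    (((Set.Ioi_infinite (1 : ℝ)).image (f := fun q => q + 1 / q) ?_)))
  · rintro _ ⟨q, hq, rfl⟩
    have := flipSum_unitBits_reflect_real hq m k hk
    have e : ∀ s, ((flipSum (Polynomial.X : ℤ[X]) m s).map (Int.castRingHom ℝ)).eval (q + 1 / q) =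
        flipSum (q + 1 / q) m s := by
      intro s
      have := map_flipSum (Polynomial.eval₂RingHom (Int.castRingHom ℝ) (q + 1 / q)) Polynomial.X m s
      simpa [Polynomial.eval_map] using this
    rw [Set.mem_ofPred_eq, e, e, this]
  · intro x hx y hy hxy
    have hx : 1 < x := hx
    have hy : 1 < y := hy
    have h : (x - y) * (x * y - 1) = 0 := by
      have hxy : x + 1 / x = y + 1 / y := hxy
      field_simp at hxy
      linear_combination hxy
    have : x * y - 1 ≠ 0 := by nlinarith
    exact sub_eq_zero.1 ((mul_eq_zero_iff_right this).1 h)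

end TriangularModel

/-! ### Matrices as states of the model -/

theorem bool_toInt_inj {a b : Bool} : a.toInt = b.toInt ↔ a = b := by
  cases a <;> cases b <;> simp

/-- A bit that starts as `h` and is successively changed by the increments `v` remains a bit
throughout and ends as `true`. -/
def BitPath : (n : ℕ) → Bool → (Fin n → ℤ) → Prop
  | 0, h, _ => h = true
  | n + 1, h, v => ∃ h' : Bool, h'.toInt = h.toInt + v 0 ∧ BitPath n h' (fun i => v i.succ)

theorem BitPath.sum_eq {n : ℕ} {h : Bool} {v : Fin n → ℤ} (hv : BitPath n h v) :
    h.toInt + ∑ i, v i = 1 := by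
  induction n generalizing h with
  | zero =>
    obtain rfl : h = true := hv
    simp
  | succ n ih =>
    obtain ⟨h', h1, h2⟩ := hv
    rw [Fin.sum_univ_succ, ← add_assoc, ← h1]
    exact ih h2

theorem bitPath_cons_zero {n : ℕ} {h : Bool} {v : Fin n → ℤ} :
    BitPath (n + 1) h (Fin.cons 0 v : Fin (n + 1) → ℤ) ↔ BitPath n h v := by
  cases h <;> simp [BitPath]

/-- Staying within the two bit values means that the increments alternate in sign and that the first
nonzero one does not leave the range; the third clause on the right is the latter. -/
theorem bitPath_iff {n : ℕ} {h : Bool} {v : Fin n → ℤ} :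
    BitPath n h v ↔ (∀ i, v i = -1 ∨ v i = 0 ∨ v i = 1) ∧ AlternatesInSign v ∧
      (∀ k, (∀ j < k, v j = 0) → v k ≠ 2 * h.toInt - 1) ∧ h.toInt + ∑ i, v i = 1 := by
  induction n generalizing h with
  | zero => cases h <;> simp [BitPath, AlternatesInSign]
  | succ n ih =>
    rw [BitPath]
    simp only [ih, Fin.forall_fin_succ (P := fun i => v i = -1 ∨ v i = 0 ∨ v i = 1),
      Fin.sum_univ_succ]
    constructor
    · rintro ⟨h', h1, h2, h3, h4, h5⟩
      have hf : ∀ k, (∀ j < k, v j = 0) → v k ≠ 2 * h.toInt - 1 := by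
        intro k hk
        rcases Fin.eq_zero_or_eq_succ k with rfl | ⟨k, rfl⟩
        · cases h <;> cases h' <;> simp only [Bool.toInt_true, Bool.toInt_false] at h1 ⊢ <;> omega
        · have h0 : v 0 = 0 := hk 0 (Fin.succ_pos k)
          have := h4 k fun j hj => hk j.succ (Fin.succ_lt_succ_iff.2 hj)
          rwa [h1, h0, add_zero] at this
      refine ⟨⟨?_, h2⟩, ?_, hf, by linarith⟩
      · cases h <;> cases h' <;> simp only [Bool.toInt_true, Bool.toInt_false] at h1 <;> omega
      · intro j k hjk hj hk hz
        obtain ⟨k, rfl⟩ := Fin.exists_succ_eq.2 (Fin.ne_zero_of_lt hjk)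
        rcases Fin.eq_zero_or_eq_succ j with rfl | ⟨j, rfl⟩
        · have := h4 k fun i hi => hz i.succ (Fin.succ_pos i) (Fin.succ_lt_succ_iff.2 hi)
          have := h2 k
          cases h <;> cases h' <;>
            simp only [Bool.toInt_true, Bool.toInt_false] at h1 this hj hk ⊢ <;> omega
        · exact h3 j k (Fin.succ_lt_succ_iff.1 hjk) hj hk fun l hl hl' =>
            hz l.succ (Fin.succ_lt_succ_iff.2 hl) (Fin.succ_lt_succ_iff.2 hl')
    · rintro ⟨⟨h0, h2⟩, h3, h4, h5⟩
      have h40 := h4 0 (by simp)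
      obtain ⟨h', h1⟩ : ∃ h' : Bool, h'.toInt = h.toInt + v 0 := by
        by_cases hv : v 0 = 0
        · exact ⟨h, by simp [hv]⟩
        · refine ⟨!h, ?_⟩
          cases h <;> simp_all
      refine ⟨h', h1, h2, h3.tail, ?_, by linarith⟩
      intro k hk hvk
      by_cases hv : v 0 = 0
      · refine h4 k.succ (fun j hj => ?_) (by rw [hvk, h1, hv, add_zero])
        rcases Fin.eq_zero_or_eq_succ j with rfl | ⟨j, rfl⟩
        · exact hv
        · exact hk j (Fin.succ_lt_succ_iff.1 hj)
      · have hne : v k.succ ≠ 0 := by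
          rw [hvk]
          cases h' <;> simp
        have := h3 0 k.succ (Fin.succ_pos k) hv hne fun l hl hl' => by
          obtain ⟨l, rfl⟩ := Fin.exists_succ_eq.2 (Fin.ne_zero_of_lt hl)
          exact hk l (Fin.succ_lt_succ_iff.1 hl')
        cases h <;> cases h' <;>
          simp only [Bool.toInt_true, Bool.toInt_false] at h1 hvk this <;> omega

/-- Starting from `false`, the condition on the first nonzero entry is automatic: an alternating
sequence of sum 1 starts with 1. -/
theorem bitPath_false_iff {n : ℕ} {v : Fin n → ℤ} :
    BitPath n false v ↔ (∀ i, v i = -1 ∨ v i = 0 ∨ v i = 1) ∧ AlternatesInSign v ∧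
      ∑ i, v i = 1 := by
  rw [bitPath_iff]
  simp only [Bool.toInt_false, zero_add, mul_zero, zero_sub]
  refine ⟨fun ⟨h1, h2, _, h3⟩ => ⟨h1, h2, h3⟩, fun ⟨h1, h2, h3⟩ => ⟨h1, h2, fun k hk hvk => ?_, h3⟩⟩
  have := (AlternatesInSign.sum_le v h2 h1).2 fun i hi hvi => by
    rcases lt_trichotomy i k with h | rfl | h
    · simp [hk i h] at hvi
    · omega
    · simp [hi k h] at hvk
  omega

-- A row is determined by the crossed bits before and after it: their differences are its matrix
-- entries, and its own bit follows the same increments.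
open Classical in
theorem crossRow_ofFn {K : Type*} [CommRing K] (r : K) (n : ℕ) (h : Bool) (s : Fin n → Bool)
    (f : List Bool → K) :
    crossRow (fun _ => 1) (fun _ => 1) (fun _ => r) 1 (List.replicate n 1) h (List.ofFn s) f =
      ∑ s' : Fin n → Bool, if BitPath n h (fun i => (s' i).toInt - (s i).toInt) then
        r ^ (∑ i, if s' i = s i then 0 else 1) * f (List.ofFn s') else 0 := by
  induction n generalizing h f with
  | zero => simp [crossRow, BitPath]
  | succ n ih =>
    rw [← (Fin.consEquiv fun _ => Bool).sum_comp, Fintype.sum_prod_type, List.replicate_succ,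
      List.ofFn_succ, crossRow, ih, ih]
    simp only [Fin.consEquiv_apply, Fin.sum_univ_succ, Fin.cons_zero, Fin.cons_succ,
      List.ofFn_succ, BitPath, Fintype.sum_bool]
    generalize s 0 = e
    cases h <;> cases e <;>
      simp [Finset.mul_sum, pow_add, mul_assoc, add_comm]

/-- The symmetric matrix with vanishing top left entry, first row `v` otherwise, and lower right
block `A`. -/
def symBorder {n : ℕ} (v : Fin n → ℤ) (A : Matrix (Fin n) (Fin n) ℤ) :
    Matrix (Fin (n + 1)) (Fin (n + 1)) ℤ :=
  Fin.cons (Fin.cons 0 v : Fin (n + 1) → ℤ) fun i => (Fin.cons (v i) (A i) : Fin (n + 1) → ℤ)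

theorem symBorder_inj {n : ℕ} {v w : Fin n → ℤ} {A B : Matrix (Fin n) (Fin n) ℤ} :
    symBorder v A = symBorder w B ↔ v = w ∧ A = B := by
  refine ⟨fun h => ⟨funext fun i => ?_, ?_⟩, by rintro ⟨rfl, rfl⟩; rfl⟩
  · simpa [symBorder] using congrFun (congrFun h 0) i.succ
  · ext i j
    simpa [symBorder] using congrFun (congrFun h i.succ) j.succ

theorem statR_eq_sum {n : ℕ} (A : Matrix (Fin n) (Fin n) ℤ) :
    statR A = ∑ i, ∑ j, if i < j ∧ A i j ≠ 0 then 1 else 0 := by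
  rw [statR, Finset.card_filter, Fintype.sum_prod_type]

theorem statR_symBorder {n : ℕ} (v : Fin n → ℤ) (A : Matrix (Fin n) (Fin n) ℤ) :
    statR (symBorder v A) = (∑ i, if v i = 0 then 0 else 1) + statR A := by
  rw [statR_eq_sum, statR_eq_sum, Fin.sum_univ_succ]
  congr 1
  · simp [Fin.sum_univ_succ, symBorder, -Finset.sum_boole]
  · simp [Fin.sum_univ_succ, symBorder, -Finset.sum_boole]

/-- The symmetric matrices with zero diagonal whose rows change the bits `s` to `true`. -/
def IsOffDiagBitMatrix {n : ℕ} (s : Fin n → Bool) (A : Matrix (Fin n) (Fin n) ℤ) : Prop :=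
  A.transpose = A ∧ (∀ i, A i i = 0) ∧ ∀ i, BitPath n (s i) (A i)

open Classical in
/-- The finite set of matrices satisfying `IsOffDiagBitMatrix`. -/
noncomputable def offDiagBitMatrices : (n : ℕ) → (Fin n → Bool) →
    Finset (Matrix (Fin n) (Fin n) ℤ)
  | 0, _ => {0}
  | n + 1, s => (Finset.univ.filter fun s' : Fin n → Bool =>
      BitPath n (s 0) fun i => (s' i).toInt - (s i.succ).toInt).biUnion fun s' =>
        (offDiagBitMatrices n s').image (symBorder fun i => (s' i).toInt - (s i.succ).toInt)

theorem mem_offDiagBitMatrices {n : ℕ} {s : Fin n → Bool} {A : Matrix (Fin n) (Fin n) ℤ} :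
    A ∈ offDiagBitMatrices n s ↔ IsOffDiagBitMatrix s A := by
  induction n with
  | zero =>
    simp [offDiagBitMatrices, IsOffDiagBitMatrix, Subsingleton.elim A 0]
  | succ n ih =>
    simp only [offDiagBitMatrices, Finset.mem_biUnion, Finset.mem_filter, Finset.mem_univ,
      true_and, Finset.mem_image, ih]
    constructor
    · rintro ⟨s', h, A, ⟨hA, hd, hp⟩, rfl⟩
      refine ⟨?_, ?_, ?_⟩
      · ext i j
        rw [Matrix.transpose_apply]
        rcases Fin.eq_zero_or_eq_succ i with rfl | ⟨i, rfl⟩ <;>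
          rcases Fin.eq_zero_or_eq_succ j with rfl | ⟨j, rfl⟩ <;> simp [symBorder]
        exact congrFun (congrFun hA _) _
      · intro i
        rcases Fin.eq_zero_or_eq_succ i with rfl | ⟨i, rfl⟩
        · simp [symBorder]
        · simpa [symBorder] using hd i
      · intro i
        rcases Fin.eq_zero_or_eq_succ i with rfl | ⟨i, rfl⟩
        · exact bitPath_cons_zero.2 h
        · exact ⟨s' i, by simp [symBorder], hp i⟩
    · rintro ⟨hA, hd, hp⟩
      have hsymm : ∀ i j, A i j = A j i := fun i j => congrFun (congrFun hA j) i
      -- The new bits are those of the remaining rows after their first entry; by symmetry they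
      -- record the change made by the first row.
      choose s' hs' hp' using fun i : Fin n => hp i.succ
      have hv : (fun i => (s' i).toInt - (s i.succ).toInt) = fun i => A 0 i.succ := by
        funext i
        rw [hs' i, hsymm 0]
        ring
      refine ⟨s', ?_, fun i j => A i.succ j.succ, ⟨?_, fun i => hd i.succ, hp'⟩, ?_⟩
      · rw [hv, ← bitPath_cons_zero]
        convert hp 0 using 1
        funext i
        rcases Fin.eq_zero_or_eq_succ i with rfl | ⟨i, rfl⟩ <;> simp [hd]
      · ext i j
        exact hsymm j.succ i.succ
      · rw [hv]
        ext i j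
        rcases Fin.eq_zero_or_eq_succ i with rfl | ⟨i, rfl⟩ <;>
          rcases Fin.eq_zero_or_eq_succ j with rfl | ⟨j, rfl⟩ <;> simp [symBorder, hd]
        exact hsymm _ _

open Classical in
theorem sum_offDiagBitMatrices_succ {K : Type*} [CommRing K] (n : ℕ) (s : Fin (n + 1) → Bool)
    (g : Matrix (Fin (n + 1)) (Fin (n + 1)) ℤ → K) :
    ∑ A ∈ offDiagBitMatrices (n + 1) s, g A =
      ∑ s' : Fin n → Bool,
        if BitPath n (s 0) (fun i => (s' i).toInt - (s i.succ).toInt) then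
          ∑ A ∈ offDiagBitMatrices n s', g (symBorder (fun i => (s' i).toInt - (s i.succ).toInt) A)
        else 0 := by
  rw [offDiagBitMatrices, Finset.sum_biUnion, Finset.sum_filter]
  · refine Finset.sum_congr rfl fun s' _ => ?_
    rw [Finset.sum_image fun A _ B _ h => (symBorder_inj.1 h).2]
  · intro s₁ _ s₂ _ h
    refine Finset.disjoint_left.2 fun A hA hB => h ?_
    obtain ⟨B, _, rfl⟩ := Finset.mem_image.1 hA
    obtain ⟨C, _, hC⟩ := Finset.mem_image.1 hB
    funext i
    have := congrFun (symBorder_inj.1 hC).1 i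
    exact bool_toInt_inj.1 (by linarith)

theorem sum_pow_statR_offDiagBitMatrices {K : Type*} [CommRing K] (r : K) (n : ℕ)
    (s : Fin n → Bool) :
    ∑ A ∈ offDiagBitMatrices n s, r ^ statR A = flipSum r n (List.ofFn s) := by
  induction n with
  | zero => simp [offDiagBitMatrices, statR, flipSum, triSum]
  | succ n ih =>
    rw [sum_offDiagBitMatrices_succ, flipSum, List.replicate_succ, List.ofFn_succ, triSum,
      crossRow_ofFn]
    refine Finset.sum_congr rfl fun s' _ => ?_
    simp only [statR_symBorder, pow_add, ← Finset.mul_sum, ih, sub_eq_zero, bool_toInt_inj]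
    congr

theorem mem_OSASM_iff {n : ℕ} (hn : Even n) {A : Matrix (Fin n) (Fin n) ℤ} :
    A ∈ OSASM n ↔ IsOffDiagBitMatrix (fun _ => false) A := by
  have hS : statS A = (if Even n then 0 else 1) ↔ ∀ i, A i i = 0 := by
    simp [hn, statS, Finset.filter_eq_empty_iff]
  constructor
  · rintro ⟨⟨hA, ht⟩, hs⟩
    exact ⟨ht, hS.1 hs, fun i => bitPath_false_iff.2
      ⟨hA.entries i, hA.row_alternates i, hA.row_sum i⟩⟩
  · rintro ⟨ht, hd, hp⟩
    have hsymm : ∀ j, (fun i => A i j) = A j := fun j => congrFun ht j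
    have h := fun i => bitPath_false_iff.1 (hp i)
    refine ⟨⟨⟨fun i => (h i).1, fun i => (h i).2.1, fun j => ?_, fun i => (h i).2.2, fun j => ?_⟩,
      ht⟩, hS.2 hd⟩
    · rw [hsymm]
      exact (h j).2.1
    · rw [show ∑ i, A i j = ∑ i, A j i from congrArg (fun f => ∑ i, f i) (hsymm j)]
      exact (h j).2.2

/-- In the first row all crossed bits start as `false`, so the entries are 0 or 1 with sum 1, and a
1 at `k` determines the row. -/
theorem bitPath_toInt_iff {m : ℕ} {s : Fin m → Bool} (k : Fin m) :
    (BitPath m false (fun i => (s i).toInt) ∧ s k = true) ↔ s = fun i => decide (i = k) := by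
  constructor
  · rintro ⟨h, hk⟩
    have hs := h.sum_eq
    rw [Bool.toInt_false, zero_add] at hs
    funext i
    by_cases hik : i = k
    · simp [hik, hk]
    · have hnn : ∀ j, 0 ≤ (s j).toInt := fun j => by cases s j <;> simp
      have := Finset.sum_le_sum_of_subset_of_nonneg (Finset.subset_univ {i, k})
        fun j _ _ => hnn j
      rw [Finset.sum_pair hik, hs, hk] at this
      cases hi : s i <;> simp_all
  · rintro rfl
    refine ⟨bitPath_false_iff.2 ⟨fun i => ?_, fun i j hij hi hj _ => ?_, ?_⟩, by simp⟩
    · by_cases h : i = k <;> simp [h]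
    · have h1 : i = k := by
        by_contra h
        simp [h] at hi
      have h2 : j = k := by
        by_contra h
        simp [h] at hj
      omega
    · rw [Finset.sum_eq_single k (fun i _ h => by simp [h]) (by simp)]
      simp

/-- Fixing the 1 of the first row leaves a single term of the recursion; the factor `r` accounts for
that entry. -/
theorem sum_pow_statR_first_row {K : Type*} [CommRing K] (r : K) (m : ℕ) (k : Fin m) :
    ∑ A ∈ (offDiagBitMatrices (m + 1) fun _ => false) with A 0 k.succ = 1, r ^ statR A =
      r * flipSum r m (unitBits m k) := by
  have hone : ∀ b : Bool, b.toInt = 1 ↔ b = true := by decide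
  rw [Finset.sum_filter, sum_offDiagBitMatrices_succ,
    Finset.sum_eq_single (fun i : Fin m => decide (i = k))]
  · obtain ⟨h1, h2⟩ := (bitPath_toInt_iff (s := fun i : Fin m => decide (i = k)) k).2 rfl
    have hsum : (∑ i : Fin m, if (decide (i = k)).toInt = 0 then 0 else 1) = 1 := by
      rw [Finset.sum_eq_single k (fun i _ h => by simp [h]) (by simp)]
      simp
    rw [if_pos (by simpa only [Bool.toInt_false, sub_zero] using h1)]
    simp only [Bool.toInt_false, sub_zero, statR_symBorder, hsum, pow_add, pow_one]
    simp only [symBorder, Fin.cons_zero, Fin.cons_succ, decide_true, Bool.toInt_true, if_true,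
      ← Finset.mul_sum, sum_pow_statR_offDiagBitMatrices, unitBits, Fin.ext_iff]
  · intro s _ hs
    rw [Ne, ← bitPath_toInt_iff k, not_and] at hs
    split_ifs with h
    · simp only [Bool.toInt_false, sub_zero] at h
      exact Finset.sum_eq_zero fun A _ => if_neg (by simpa [symBorder, hone] using hs h)
    · rfl
  · simp

/-! ### Translation to the generating function of OSASM -/

/-- The generating function of the off-diagonally symmetric alternating sign matrices with fixed
position of the `1` in the first row. -/
noncomputable def osasmPoly (n t : ℕ) : ℤ[X] :=
  ∑ A ∈ (OSASM_finite n).toFinset with statT A = t, Polynomial.X ^ statR A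

theorem statT_bounds {m : ℕ} (hm : Even (m + 1)) {A : Matrix (Fin (m + 1)) (Fin (m + 1)) ℤ}
    (hA : A ∈ OSASM (m + 1)) : 2 ≤ statT A ∧ statT A ≤ m + 1 := by
  obtain ⟨j, hj, -⟩ := hA.1.1.exists_unique_one_first_row (Nat.succ_pos m)
  rw [hA.1.1.statT_eq _ j hj]
  have h0 : j ≠ 0 := by
    rintro rfl
    have := ((mem_OSASM_iff hm).1 hA).2.1 0
    rw [show (⟨0, Nat.succ_pos m⟩ : Fin (m + 1)) = 0 from rfl, this] at hj
    exact zero_ne_one hj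
  have := Fin.val_ne_zero_iff.2 h0
  omega

/-- The shift by 2 comes from the diagonal zero in the first column and from the 1-based index in
`statT`. -/
theorem osasmPoly_succ {m : ℕ} (hm : Even (m + 1)) (k : ℕ) (hk : k < m) :
    osasmPoly (m + 1) (k + 2) = Polynomial.X * flipSum Polynomial.X m (unitBits m k) := by
  rw [← sum_pow_statR_first_row _ m ⟨k, hk⟩, osasmPoly]
  refine Finset.sum_congr ?_ fun _ _ => rfl
  ext A
  rw [Finset.mem_filter, Finset.mem_filter, Set.Finite.mem_toFinset, mem_offDiagBitMatrices,
    mem_OSASM_iff hm]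
  refine and_congr_right fun hA => ?_
  have h := ((mem_OSASM_iff hm).2 hA).1.1
  constructor
  · intro ht
    obtain ⟨j, hj, -⟩ := h.exists_unique_one_first_row (Nat.succ_pos m)
    rw [h.statT_eq _ j hj] at ht
    obtain rfl : j = Fin.succ ⟨k, hk⟩ := by
      ext
      simp only [Fin.val_succ]
      omega
    exact hj
  · intro h1
    rw [h.statT_eq (Nat.succ_pos m) _ h1]
    simp

theorem osasmPoly_reflect (n t : ℕ) (hn : Even n) (hn0 : n ≠ 0) (ht : t ≤ n + 2) :
    osasmPoly n (n + 2 - t) = osasmPoly n t := by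
  obtain ⟨m, rfl⟩ := Nat.exists_eq_succ_of_ne_zero hn0
  have hzero : ∀ t, ¬(2 ≤ t ∧ t ≤ m + 1) → osasmPoly (m + 1) t = 0 := by
    intro t ht
    rw [osasmPoly, Finset.filter_false_of_mem, Finset.sum_empty]
    intro A hA hAt
    exact ht (hAt ▸ statT_bounds hn (by simpa using hA))
  simp only [Nat.succ_eq_add_one] at *
  by_cases h : 2 ≤ t ∧ t ≤ m + 1
  · obtain ⟨k, rfl⟩ := Nat.exists_eq_add_of_le' h.1
    -- With `t = k + 2` and `n = m + 1`, the reflection `t ↦ n + 2 - t` is `k ↦ m - 1 - k`.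
    rw [show m + 1 + 2 - (k + 2) = (m - 1 - k) + 2 by omega, osasmPoly_succ hn _ (by omega),
      osasmPoly_succ hn _ (by omega), ← flipSum_unitBits_reflect _ _ (by omega)]
  · rw [hzero _ h, hzero _ (by omega)]

theorem coeff_osasmPoly (n t r : ℕ) :
    (osasmPoly n t).coeff r = {A | A ∈ OSASM n ∧ statR A = r ∧ statT A = t}.ncard := by
  have : {A | A ∈ OSASM n ∧ statR A = r ∧ statT A = t} =
      (((OSASM_finite n).toFinset.filter fun A => statT A = t).filter fun A => r = statR A :
        Finset (Matrix (Fin n) (Fin n) ℤ)) := by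
    ext A
    simp only [Set.mem_ofPred_eq, Finset.coe_filter, Finset.mem_filter, Set.Finite.mem_toFinset]
    tauto
  rw [this, Set.ncard_coe_finset, osasmPoly, Polynomial.finsetSum_coeff]
  simp [Polynomial.coeff_X_pow]

theorem osasmGenFun_eq_sum (n : ℕ) (hn : Even n) (hn0 : n ≠ 0) :
    osasmGenFun n = ∑ t ∈ Finset.range (n + 3),
      LaurentPolynomial.C (osasmPoly n t) * LaurentPolynomial.T t := by
  obtain ⟨m, rfl⟩ := Nat.exists_eq_succ_of_ne_zero hn0
  rw [osasmGenFun, ← Finset.sum_fiberwise_of_maps_to (g := statT) (t := Finset.range (m.succ + 3))]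
  · refine Finset.sum_congr rfl fun t _ => ?_
    rw [osasmPoly, map_sum, Finset.sum_mul]
    refine Finset.sum_congr rfl fun A hA => ?_
    rw [(Finset.mem_filter.1 hA).2, map_pow, LaurentPolynomial.T_pow, mul_one]
  · intro A hA
    have := statT_bounds hn (A := A) (by simpa using hA)
    simp only [Finset.mem_range]
    omega

theorem mainTheorem4 (n : ℕ) (hn : 1 ≤ n) :
    osasmGenFun (2 * n) =
        LaurentPolynomial.T 1 ^ (2 * n + 2) * LaurentPolynomial.invert (osasmGenFun (2 * n)) ∧
    ∀ (r₀ : ℕ) (t₀ : ℤ),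
      {A | A ∈ OSASM (2 * n) ∧ statR A = r₀ ∧ (statT A : ℤ) = t₀}.ncard =
      {A | A ∈ OSASM (2 * n) ∧ statR A = r₀ ∧ (statT A : ℤ) = 2 * (n : ℤ) + 2 - t₀}.ncard := by
  have hev : Even (2 * n) := even_two_mul n
  have hn0 : 2 * n ≠ 0 := by omega
  constructor
  · rw [osasmGenFun_eq_sum _ hev hn0, map_sum, Finset.mul_sum, ← Finset.sum_range_reflect]
    refine Finset.sum_congr rfl fun t ht => ?_
    have ht : t ≤ 2 * n + 2 := by
      have := Finset.mem_range.1 ht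
      omega
    rw [show 2 * n + 3 - 1 - t = 2 * n + 2 - t by omega, osasmPoly_reflect _ _ hev hn0 ht, map_mul,
      LaurentPolynomial.invert_C, LaurentPolynomial.invert_T, LaurentPolynomial.T_pow,
      mul_left_comm, ← LaurentPolynomial.T_add]
    congr 2
    push_cast [ht]
    ring
  · intro r₀ t₀
    by_cases ht : 0 ≤ t₀ ∧ t₀ ≤ 2 * n + 2
    · lift t₀ to ℕ using ht.1
      have h := congrArg (fun P => Polynomial.coeff P r₀)
        (osasmPoly_reflect (2 * n) t₀ hev hn0 (by omega))
      simp only [coeff_osasmPoly] at h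
      have e : ∀ A : Matrix (Fin (2 * n)) (Fin (2 * n)) ℤ,
          ((statT A : ℤ) = 2 * (n : ℤ) + 2 - (t₀ : ℤ)) ↔ statT A = 2 * n + 2 - t₀ := by
        intro A
        omega
      simp only [e, Nat.cast_inj]
      exact_mod_cast h.symm
    · obtain ⟨m, hm⟩ := Nat.exists_eq_succ_of_ne_zero hn0
      have hb : ∀ A ∈ OSASM (2 * n), 2 ≤ statT A ∧ statT A ≤ 2 * n := by
        rw [hm] at hev ⊢
        exact fun A hA => statT_bounds hev hA
      -- Outside the range `0, …, 2 * n + 2`, which the reflection preserves, both sets are empty.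
      have hempty : ∀ t : ℤ, ¬(0 ≤ t ∧ t ≤ 2 * n + 2) →
          {A | A ∈ OSASM (2 * n) ∧ statR A = r₀ ∧ (statT A : ℤ) = t} = ∅ := by
        intro t ht
        refine Set.eq_empty_iff_forall_notMem.2 fun A hA => ht ?_
        have := hb A hA.1
        have := hA.2.2
        omega
      rw [hempty _ ht, hempty _ (by omega)]
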